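/- All Banach spaces are real. Let $X\neq\{0\}$ be a separable Banach space with the Daugavet property, i.e. every bounded linear operator $T\colon X\to X$ of rank one satisfies $\|\mathrm{Id}+T\|=1+\|T\|$. Say that $X$ embeds into a Banach space $Y$ if there is a bounded linear operator $J\colon X\to Y$ which is a homeomorphism onto its range. (1) $X$ does not embed into any unconditional sum of reflexive spaces. That is, let $Y$ be a Banach space, $(V_i)_{i\in I}$ a family of subspaces of $Y$ indexed by an arbitrary set $I$, and $(P_i)_{i\in I}$ bounded linear projections with $P_i(Y)=V_i$ and $P_i|_{V_j}=0$ for $i\ne j$, such that $y=\sum_{i\in I}P_iy$ for every $y\in Y$, the sum converging unconditionally in norm. If every $V_i$ is reflexive, then $X$ does not embed into $Y$. (2) In particular, $X$ does not embed into any Banach space with an unconditional basis. Here an unconditional basis of a Banach space $Y$ is a family $(e_i)_{i\in I}$ in $Y$, indexed by an arbitrary set $I$, for which there are continuous linear functionals $(f_i)_{i\in I}$ on $Y$ with $f_i(e_j)=\delta_{ij}$ and $y=\sum_{i\in I}f_i(y)e_i$ for every $y\in Y$, the sum converging unconditionally in norm. -/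

import Mathlib

/-- A real Banach space `X` has the Daugavet property if every bounded operator `T : X → X` of
rank one satisfies the Daugavet equation `‖Id + T‖ = 1 + ‖T‖`. -/
def HasDaugavetProperty (X : Type*) [NormedAddCommGroup X] [NormedSpace ℝ X] : Prop :=
  ∀ T : X →L[ℝ] X, LinearMap.rank (T : X →ₗ[ℝ] X) = 1 →
    ‖ContinuousLinearMap.id ℝ X + T‖ = 1 + ‖T‖

/-- `X` embeds into `Y`: there is a bounded linear operator `X → Y` which is a homeomorphism
onto its range, i.e. `X` is isomorphic to a subspace of `Y`. -/
def EmbedsInto (X Y : Type*) [NormedAddCommGroup X] [NormedSpace ℝ X]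
    [NormedAddCommGroup Y] [NormedSpace ℝ Y] : Prop :=
  ∃ J : X →L[ℝ] Y, Topology.IsEmbedding J

/-- A real normed space is reflexive if its canonical map into the bidual is onto. -/
def IsReflexiveSpace (E : Type*) [NormedAddCommGroup E] [NormedSpace ℝ E] : Prop :=
  Function.Surjective (NormedSpace.inclusionInDoubleDual ℝ E)

/-- `Y` is the unconditional sum of its subspaces `V i`, with associated bounded projections
`P i` from `Y` onto `V i`: the projections are mutually annihilating, and every `y` is the sum of
the unconditionally convergent series `∑ i, P i y`. -/
structure IsUnconditionalSum {ι Y : Type*} [NormedAddCommGroup Y] [NormedSpace ℝ Y]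
    (V : ι → Submodule ℝ Y) (P : ι → Y →L[ℝ] Y) : Prop where
  range_eq : ∀ i, LinearMap.range (P i : Y →ₗ[ℝ] Y) = V i
  apply_self : ∀ i, ∀ y ∈ V i, P i y = y
  apply_of_ne : ∀ i j, i ≠ j → ∀ y ∈ V j, P i y = 0
  hasSum : ∀ y, HasSum (fun i => P i y) y

/-! In a Daugavet space, vectors almost `ℓ¹`-orthogonal to a finite-dimensional `E` meet every slice
of the unit ball, and are even weakly dense in it (`mem_closure_image_almostL1`). If `T` has weak
ultralimits, weak approximation improves to norm approximation of `T x`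
(`exists_mem_almostL1_norm_lt`): otherwise an inductive construction would violate James'
double-limit criterion. Let `J` embed `X` into an unconditional sum. Finite sums of the `P i ∘ J`
have weak ultralimits by reflexivity, so a vector can be replaced by one almost `ℓ¹`-orthogonal to a
given vector while a prescribed partial sum of its image barely changes. Iterating
(`exists_norm_ge`) gives arbitrarily long `s` with `J s` close to a partial sum of `J x`, `‖x‖ ≤ 1`.
Unconditionality bounds such partial sums, so `J` is not bounded below. -/

open Filter Topology Set

/-! ### Almost `ℓ¹`-orthogonal vectors -/

section AlmostL1

variable {X : Type*} [NormedAddCommGroup X] [NormedSpace ℝ X]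

/-- The vectors `z` of the unit ball which are `ℓ¹`-orthogonal to the subspace `E`, up to the
factor `1 - η`. -/
def almostL1 (E : Submodule ℝ X) (η : ℝ) : Set X :=
  {z | ‖z‖ ≤ 1 ∧ ∀ e ∈ E, ∀ t : ℝ, (1 - η) * (‖e‖ + |t|) ≤ ‖e + t • z‖}

theorem almostL1_mono {E E' : Submodule ℝ X} {η η' : ℝ} (hE : E ≤ E') (hη : η' ≤ η) :
    almostL1 E' η' ⊆ almostL1 E η := by
  rintro z ⟨hz, h⟩
  refine ⟨hz, fun e he t => le_trans ?_ (h e (hE he) t)⟩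
  gcongr

/-- Split off `z'` first, from `e + (t * a) • z ∈ E'`, then split off `z` from `e`; the losses
multiply to at most `η + η'`. -/
theorem add_smul_mem_almostL1 {E E' : Submodule ℝ X} {η η' a b : ℝ} {z z' : X}
    (hη : 0 ≤ η) (hη' : 0 ≤ η') (hη'1 : η' ≤ 1)
    (hz : z ∈ almostL1 E η) (hz' : z' ∈ almostL1 E' η') (hE : E ≤ E') (hzE : z ∈ E')
    (ha : 0 ≤ a) (hb : 0 ≤ b) (hab : a + b = 1) :
    a • z + b • z' ∈ almostL1 E (η + η') := by
  refine ⟨?_, fun e he t => ?_⟩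
  · calc ‖a • z + b • z'‖ ≤ ‖a • z‖ + ‖b • z'‖ := norm_add_le _ _
      _ = a * ‖z‖ + b * ‖z'‖ := by
        rw [norm_smul, norm_smul, Real.norm_of_nonneg ha, Real.norm_of_nonneg hb]
      _ ≤ a * 1 + b * 1 := by gcongr; exacts [hz.1, hz'.1]
      _ = 1 := by linarith
  · have h1 := hz.2 e he (t * a)
    have h2 := hz'.2 (e + (t * a) • z) (E'.add_mem (hE he) (E'.smul_mem _ hzE)) (t * b)
    rw [abs_mul, abs_of_nonneg ha] at h1
    rw [abs_mul, abs_of_nonneg hb] at h2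
    have heq : e + t • (a • z + b • z') = e + (t * a) • z + (t * b) • z' := by module
    rw [heq]
    refine le_trans ?_ h2
    have h3 : (1 - η') * ((1 - η) * (‖e‖ + |t| * a) + |t| * b)
        ≤ (1 - η') * (‖e + (t * a) • z‖ + |t| * b) := by
      have : 0 ≤ 1 - η' := by linarith
      gcongr
    refine le_trans ?_ h3
    have hB : 0 ≤ |t| * b := by positivity
    have hA : 0 ≤ ‖e‖ + |t| * a := by positivity
    have hs : ‖e‖ + |t| = (‖e‖ + |t| * a) + |t| * b := by
      have : |t| = |t| * (a + b) := by rw [hab, mul_one]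
      linarith
    rw [hs]
    nlinarith [mul_nonneg (mul_nonneg hη hη') hA, mul_nonneg hη hB]

/-- The estimate `2 - η ≤ ‖x + z‖` on unit vectors `x` gives the two-parameter estimate. -/
theorem mul_add_le_norm_smul_add_smul {x z : X} {η s t : ℝ} (hx : ‖x‖ = 1) (hz : ‖z‖ ≤ 1)
    (hη : 0 ≤ η) (h : 2 - η ≤ ‖x + z‖) (hs : 0 ≤ s) (ht : 0 ≤ t) :
    (1 - η) * (s + t) ≤ ‖s • x + t • z‖ := by
  rcases le_total s t with hst | hst
  · have h1 : t • (x + z) = (s • x + t • z) + (t - s) • x := by module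
    have h2 := norm_add_le (s • x + t • z) ((t - s) • x)
    rw [← h1, norm_smul, norm_smul, hx, Real.norm_of_nonneg ht,
      Real.norm_of_nonneg (sub_nonneg.2 hst)] at h2
    nlinarith [mul_le_mul_of_nonneg_left h ht, mul_nonneg hη hs]
  · have h1 : s • (x + z) = (s • x + t • z) + (s - t) • z := by module
    have h2 := norm_add_le (s • x + t • z) ((s - t) • z)
    rw [← h1, norm_smul, norm_smul, Real.norm_of_nonneg hs,
      Real.norm_of_nonneg (sub_nonneg.2 hst)] at h2
    nlinarith [mul_le_mul_of_nonneg_left h hs, mul_nonneg hη ht,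
      mul_le_mul_of_nonneg_left hz (sub_nonneg.2 hst)]

/-- A single `almostL1 E η` need not be convex. Over all `E` and `η`, the approximant of `q` may be
chosen orthogonal to `E` and to the approximant of `p`, so their combinations remain admissible. -/
theorem convex_iInter_closure_image_almostL1 {H : Type*} [NormedAddCommGroup H] [NormedSpace ℝ H]
    (F : X →L[ℝ] H) :
    Convex ℝ {p | ∀ (E : Submodule ℝ X) (η : ℝ), FiniteDimensional ℝ E → 0 < η →
      p ∈ closure (F '' almostL1 E η)} := by
  intro p hp q hq a b ha hb hab E η hE hη
  rw [Metric.mem_closure_iff]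
  intro r hr
  set κ := min (η / 2) 1 with hκ
  have hκ0 : 0 < κ := by positivity
  obtain ⟨_, ⟨z, hz, rfl⟩, hpz⟩ := Metric.mem_closure_iff.1 (hp E κ hE hκ0) r hr
  have hE' : FiniteDimensional ℝ (E ⊔ Submodule.span ℝ {z} : Submodule ℝ X) := inferInstance
  obtain ⟨_, ⟨z', hz', rfl⟩, hqz⟩ := Metric.mem_closure_iff.1 (hq _ κ hE' hκ0) r hr
  refine ⟨F (a • z + b • z'), ⟨_, almostL1_mono le_rfl ?_ (add_smul_mem_almostL1 hκ0.le hκ0.le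
    (min_le_right _ _) hz hz' le_sup_left
    (Submodule.mem_sup_right (Submodule.mem_span_singleton_self z)) ha hb hab), rfl⟩, ?_⟩
  · linarith [min_le_left (η / 2) 1]
  · have hc := convex_ball (0 : H) r
    have h1 : p - F z ∈ Metric.ball (0 : H) r := by simpa [dist_eq_norm] using hpz
    have h2 : q - F z' ∈ Metric.ball (0 : H) r := by simpa [dist_eq_norm] using hqz
    have h3 := hc h1 h2 ha hb hab
    rw [mem_ball_zero_iff] at h3
    rw [dist_eq_norm]
    rwa [show a • p + b • q - F (a • z + b • z') = a • (p - F z) + b • (q - F z') by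
      simp only [map_add, map_smul]; module]

end AlmostL1

/-! ### Slices and weak density in Daugavet spaces -/

section Daugavet

variable {X : Type*} [NormedAddCommGroup X] [NormedSpace ℝ X]

theorem HasDaugavetProperty.norm_id_add_smulRight (hX : HasDaugavetProperty X)
    {f : X →L[ℝ] ℝ} {x : X} (hf : f ≠ 0) (hx : x ≠ 0) :
    ‖ContinuousLinearMap.id ℝ X + f.smulRight x‖ = 1 + ‖f‖ * ‖x‖ := by
  rw [hX, ContinuousLinearMap.norm_smulRight_apply]
  have hr : LinearMap.range ((f.smulRight x : X →L[ℝ] X) : X →ₗ[ℝ] X)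
      = Submodule.span ℝ {x} := by
    ext y
    simp only [LinearMap.mem_range, Submodule.mem_span_singleton]
    constructor
    · rintro ⟨z, rfl⟩
      exact ⟨f z, by simp⟩
    · rintro ⟨a, rfl⟩
      obtain ⟨w, hw⟩ : ∃ w, f w ≠ 0 := by
        by_contra! h
        exact hf (ContinuousLinearMap.ext h)
      exact ⟨(a / f w) • w, by simp [smul_smul, hw]⟩
  rw [LinearMap.rank, hr, rank_submodule_eq_one_iff]
  exact ⟨x, Submodule.mem_span_singleton_self x, hx, le_rfl⟩

/-- A slice of the unit ball of a space with the Daugavet property contains a smaller slice all of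
whose elements are almost `ℓ¹`-orthogonal to a given unit vector. -/
theorem HasDaugavetProperty.exists_subslice (hX : HasDaugavetProperty X)
    {f : X →L[ℝ] ℝ} {c : ℝ} (hc : c < ‖f‖) {x : X} (hx : ‖x‖ = 1) {ε : ℝ} (hε : 0 < ε) :
    ∃ (g : X →L[ℝ] ℝ) (d : ℝ), d < ‖g‖ ∧
      ∀ z, ‖z‖ ≤ 1 → d < g z → c < f z ∧ 2 - ε ≤ ‖x + z‖ := by
  have hx0 : x ≠ 0 := by rintro rfl; simp at hx
  rcases eq_or_ne f 0 with rfl | hf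
  · obtain ⟨g, hg, hgx⟩ := exists_dual_vector ℝ x (by simp [hx])
    refine ⟨g, 1 - ε, by linarith, fun z hz hgz => ⟨by simpa using hc, ?_⟩⟩
    have h1 := (le_abs_self _).trans (g.le_opNorm (x + z))
    rw [hg, one_mul, map_add, hgx, hx] at h1
    simp only [RCLike.ofReal_real_eq_id, id] at h1
    linarith
  have hf0 : 0 < ‖f‖ := norm_pos_iff.2 hf
  -- On the slice `f₁ + g > 2 - 2δ` both functionals exceed `1 - 2δ`. Hence `f z > ‖f‖ (1 - 2δ) ≥
  -- c`, and `g x > 1 - δ` gives `‖x + z‖ > 2 - 3δ`.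
  obtain ⟨δ, hδ, hδ1, hδε, hδc⟩ : ∃ δ > 0, δ ≤ 1 ∧ δ ≤ ε / 3 ∧ δ * (2 * ‖f‖) ≤ ‖f‖ - c := by
    refine ⟨min 1 (min (ε / 3) ((‖f‖ - c) / (2 * ‖f‖))), ?_, min_le_left _ _,
      (min_le_right _ _).trans (min_le_left _ _), ?_⟩
    · have := sub_pos.2 hc
      positivity
    · rw [← le_div_iff₀ (by positivity)]
      exact (min_le_right _ _).trans (min_le_right _ _)
  set f₁ : X →L[ℝ] ℝ := ‖f‖⁻¹ • f with hf₁
  have hf₁n : ‖f₁‖ = 1 := by rw [hf₁, norm_smul, norm_inv, norm_norm, inv_mul_cancel₀ hf0.ne']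
  have hf₁0 : f₁ ≠ 0 := by rintro h; simp [h] at hf₁n
  have hn := hX.norm_id_add_smulRight hf₁0 hx0
  rw [hf₁n, hx] at hn
  obtain ⟨z₀, hz₀, hz₀'⟩ : ∃ z : X, ‖z‖ ≤ 1 ∧ 2 - δ < ‖z + f₁ z • x‖ := by
    by_contra! h
    have : ‖ContinuousLinearMap.id ℝ X + f₁.smulRight x‖ ≤ max (2 - δ) 0 := by
      refine ContinuousLinearMap.opNorm_le_of_unit_norm (le_max_right _ _) fun z hz => ?_
      refine le_trans ?_ (le_max_left _ _)
      simpa using h z hz.le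
    rw [hn] at this
    rcases le_max_iff.1 this with h | h <;> linarith
  wlog hpos : 0 ≤ f₁ z₀ generalizing z₀
  · refine this (-z₀) (by simpa using hz₀) ?_ (by simp only [map_neg]; linarith)
    rwa [map_neg, ← norm_neg, show -(-z₀ + -f₁ z₀ • x) = z₀ + f₁ z₀ • x by module]
  obtain ⟨g, hg, hgz⟩ := exists_dual_vector'' ℝ (z₀ + f₁ z₀ • x)
  have hle : ∀ h : X →L[ℝ] ℝ, ‖h‖ ≤ 1 → ∀ y, ‖y‖ ≤ 1 → h y ≤ 1 := fun h hh y hy =>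
    (le_abs_self _).trans ((h.le_opNorm y).trans (mul_le_one₀ hh (norm_nonneg _) hy))
  have hgz' : 2 - δ < g z₀ + f₁ z₀ * g x := by
    have : g (z₀ + f₁ z₀ • x) = g z₀ + f₁ z₀ * g x := by simp
    rw [← this, hgz]
    simpa using hz₀'
  have hg1 := hle g hg z₀ hz₀
  have hg2 := hle g hg x hx.le
  have hf1 := hle f₁ hf₁n.le z₀ hz₀
  have hfx : 1 - δ < g x := by nlinarith
  have hfz : 1 - δ < f₁ z₀ := by nlinarith
  have hgz0 : 1 - δ < g z₀ := by nlinarith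
  refine ⟨f₁ + g, 2 - 2 * δ, ?_, fun z hz hgz => ?_⟩
  · have h1 := (le_abs_self _).trans ((f₁ + g).le_opNorm z₀)
    have h2 : ‖f₁ + g‖ * ‖z₀‖ ≤ ‖f₁ + g‖ * 1 := by gcongr
    simp only [add_apply] at h1
    linarith
  · rw [add_apply] at hgz
    have h1 := hle g hg z hz
    have h2 := hle f₁ hf₁n.le z hz
    constructor
    · have h3 : f z = ‖f‖ * f₁ z := by
        rw [hf₁, smul_apply, smul_eq_mul, mul_inv_cancel_left₀ hf0.ne']
      rw [h3]
      nlinarith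
    · have h3 := (le_abs_self _).trans (g.le_opNorm (x + z))
      have h4 : ‖g‖ * ‖x + z‖ ≤ 1 * ‖x + z‖ := by gcongr
      rw [map_add] at h3
      linarith

theorem HasDaugavetProperty.exists_subslice_finset (hX : HasDaugavetProperty X)
    {f : X →L[ℝ] ℝ} {c : ℝ} (hc : c < ‖f‖) {ε : ℝ} (hε : 0 < ε) {S : Set X} (hS : S.Finite)
    (hS1 : ∀ x ∈ S, ‖x‖ = 1) :
    ∃ (g : X →L[ℝ] ℝ) (d : ℝ), d < ‖g‖ ∧
      ∀ z, ‖z‖ ≤ 1 → d < g z → c < f z ∧ ∀ x ∈ S, 2 - ε ≤ ‖x + z‖ := by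
  induction S, hS using Set.Finite.induction_on with
  | empty => exact ⟨f, c, hc, fun z _ h => ⟨h, by simp⟩⟩
  | @insert x S _ _ ih =>
    obtain ⟨g, d, hd, hg⟩ := ih fun y hy => hS1 y (mem_insert_of_mem _ hy)
    obtain ⟨g', d', hd', hg'⟩ := hX.exists_subslice hd (hS1 x (mem_insert _ _)) hε
    refine ⟨g', d', hd', fun z hz h => ?_⟩
    obtain ⟨h1, h2⟩ := hg' z hz h
    obtain ⟨h3, h4⟩ := hg z hz h1
    exact ⟨h3, by rintro y (rfl | hy); exacts [h2, h4 y hy]⟩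

theorem HasDaugavetProperty.exists_mem_almostL1_lt [Nontrivial X] (hX : HasDaugavetProperty X)
    {f : X →L[ℝ] ℝ} {c : ℝ} (hc : c < ‖f‖) (E : Submodule ℝ X) [FiniteDimensional ℝ E]
    {η : ℝ} (hη : 0 < η) : ∃ z ∈ almostL1 E η, c < f z := by
  have hK : IsCompact (((↑) : E → X) '' Metric.sphere (0 : E) 1) :=
    (isCompact_sphere (0 : E) 1).image continuous_subtype_val
  obtain ⟨N, hNK, hN, hcov⟩ := hK.finite_cover_balls (half_pos hη)
  -- The extra unit vector forces `‖z‖` close to `1` even when `E` is trivial; this settles the case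
  -- `e = 0`.
  obtain ⟨x₀, hx₀⟩ := exists_norm_eq X zero_le_one
  have hS1 : ∀ x ∈ insert x₀ N, ‖x‖ = 1 := by
    rintro x (rfl | hx)
    · exact hx₀
    · obtain ⟨y, hy, rfl⟩ := hNK hx
      simpa using hy
  obtain ⟨g, d, hd, hg⟩ := hX.exists_subslice_finset hc (half_pos hη) (hN.insert x₀) hS1
  obtain ⟨z, hz, hdz⟩ : ∃ z, ‖z‖ ≤ 1 ∧ d < g z := by
    by_contra! h
    have h0 : 0 ≤ d := by simpa using h 0 (by simp)
    refine hd.not_ge (g.opNorm_le_of_unit_norm h0 fun z hz => ?_)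
    rw [Real.norm_eq_abs, abs_le]
    have h1 := h (-z) (by simp [hz])
    rw [map_neg] at h1
    exact ⟨by linarith, h z hz.le⟩
  obtain ⟨hcz, hSz⟩ := hg z hz hdz
  have hsph : ∀ x ∈ E, ‖x‖ = 1 → 2 - η ≤ ‖x + z‖ := by
    intro x hxE hx
    have hxK : x ∈ ((↑) : E → X) '' Metric.sphere (0 : E) 1 := ⟨⟨x, hxE⟩, by simpa using hx, rfl⟩
    obtain ⟨y, hy, hxy⟩ := mem_iUnion₂.1 (hcov hxK)
    have h1 := hSz y (mem_insert_of_mem _ hy)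
    have h2 : y + z = (x + z) - (x - y) := by abel
    have h3 := norm_sub_le (x + z) (x - y)
    rw [← h2] at h3
    rw [Metric.mem_ball, dist_eq_norm] at hxy
    linarith
  refine ⟨z, ⟨hz, ?_⟩, hcz⟩
  have key : ∀ e ∈ E, ∀ t : ℝ, 0 ≤ t → (1 - η) * (‖e‖ + t) ≤ ‖e + t • z‖ := by
    intro e he t ht
    rcases eq_or_ne e 0 with rfl | he0
    · have h1 := hSz x₀ (mem_insert _ _)
      have h2 := norm_add_le x₀ z
      have h3 : 1 - η ≤ ‖z‖ := by linarith
      simp only [norm_zero, zero_add, norm_smul, Real.norm_of_nonneg ht]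
      rw [mul_comm]
      gcongr
    · have hn : ‖e‖ ≠ 0 := norm_ne_zero_iff.2 he0
      have h1 : ‖‖e‖⁻¹ • e‖ = 1 := by rw [norm_smul, norm_inv, norm_norm, inv_mul_cancel₀ hn]
      have h2 := mul_add_le_norm_smul_add_smul h1 hz hη.le
        (hsph _ (E.smul_mem _ he) h1) (norm_nonneg e) ht
      rwa [smul_inv_smul₀ hn] at h2
  intro e he t
  rcases le_total 0 t with ht | ht
  · simpa [abs_of_nonneg ht] using key e he t ht
  · have h1 := key (-e) (E.neg_mem he) (-t) (by linarith)
    rw [abs_of_nonpos ht]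
    rwa [norm_neg, ← norm_neg (-e + _), show -(-e + -t • z) = e + t • z by module] at h1

/-- In a space with the Daugavet property, the elements of the unit ball which are almost
`ℓ¹`-orthogonal to a finite-dimensional subspace are weakly dense in the unit ball. -/
theorem HasDaugavetProperty.mem_closure_image_almostL1 [Nontrivial X] (hX : HasDaugavetProperty X)
    {H : Type*} [NormedAddCommGroup H] [NormedSpace ℝ H] [FiniteDimensional ℝ H]
    (F : X →L[ℝ] H) {x : X} (hx : ‖x‖ ≤ 1) (E : Submodule ℝ X) [FiniteDimensional ℝ E]
    {η : ℝ} (hη : 0 < η) : F x ∈ closure (F '' almostL1 E η) := by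
  have : ProperSpace H := FiniteDimensional.proper ℝ H
  by_contra hcon
  set I := {i : Submodule ℝ X × ℝ // FiniteDimensional ℝ i.1 ∧ 0 < i.2}
  set A : I → Set H := fun i => closure (F '' almostL1 i.1.1 i.1.2) with hA
  have : Nonempty I := ⟨⟨(E, η), inferInstance, hη⟩⟩
  set L : Set H := ⋂ i, A i with hL
  have hLc : Convex ℝ L := by
    convert convex_iInter_closure_image_almostL1 F using 1
    ext p
    simp only [hL, hA, mem_iInter, mem_ofPred_eq]
    exact ⟨fun h E η hE hη => h ⟨(E, η), hE, hη⟩, fun h i => h _ _ i.2.1 i.2.2⟩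
  have hLcl : IsClosed L := isClosed_iInter fun i => isClosed_closure
  have hxL : F x ∉ L := fun h => hcon (mem_iInter.1 h ⟨(E, η), inferInstance, hη⟩)
  -- The slice `φ ∘ F > u` meets every `almostL1 E' η'`, yet by compactness the half-space `u ≤ φ`,
  -- within a large ball, must miss one of the closures.
  obtain ⟨φ, u, hφL, hφx⟩ := geometric_hahn_banach_closed_point hLc hLcl hxL
  have hdir : Directed (· ⊇ ·) A := by
    rintro ⟨⟨E₁, η₁⟩, h₁, h₁'⟩ ⟨⟨E₂, η₂⟩, h₂, h₂'⟩
    simp only at h₁ h₂ h₁' h₂'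
    refine ⟨⟨(E₁ ⊔ E₂, min η₁ η₂), inferInstance, lt_min h₁' h₂'⟩, ?_, ?_⟩
    · exact closure_mono (image_mono (almostL1_mono le_sup_left (min_le_left _ _)))
    · exact closure_mono (image_mono (almostL1_mono le_sup_right (min_le_right _ _)))
  set K : Set H := {p | u ≤ φ p} ∩ Metric.closedBall 0 ‖F‖ with hKdef
  have hK : IsCompact K := (isCompact_closedBall (0 : H) ‖F‖).inter_left
    (isClosed_le continuous_const φ.continuous)
  have hempty : K ∩ ⋂ i, A i = ∅ := by
    ext p
    simp only [mem_inter_iff, mem_empty_iff_false, iff_false, not_and]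
    exact fun hp hpL => (hφL p hpL).not_ge hp.1
  obtain ⟨⟨⟨E', η'⟩, hE', hη'⟩, hi⟩ :=
    hK.elim_directed_family_closed A (fun i => isClosed_closure) hempty hdir
  simp only at hE' hη'
  have hlt : u < ‖φ.comp F‖ := by
    refine hφx.trans_le ((le_abs_self _).trans (((φ.comp F).le_opNorm x).trans ?_))
    exact mul_le_of_le_one_right (norm_nonneg _) hx
  obtain ⟨z, hz, huz⟩ := hX.exists_mem_almostL1_lt hlt E' hη'
  have : F z ∈ (∅ : Set H) := by
    rw [← hi]
    refine ⟨⟨huz.le, ?_⟩, subset_closure ⟨z, hz, rfl⟩⟩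
    rw [mem_closedBall_zero_iff]
    exact (F.le_opNorm z).trans (mul_le_of_le_one_right (norm_nonneg _) hz.1)
  exact this

end Daugavet

/-! ### Weak limits along ultrafilters -/

section WeakUltralimits

variable {X Y : Type*} [NormedAddCommGroup X] [NormedSpace ℝ X]
  [NormedAddCommGroup Y] [NormedSpace ℝ Y]

/-- A bounded sequence of functionals has a weak-star limit along every ultrafilter. -/
theorem exists_forall_tendsto_apply_of_norm_le (𝒰 : Ultrafilter ℕ) {φ : ℕ → X →L[ℝ] ℝ} {C : ℝ}
    (h : ∀ n, ‖φ n‖ ≤ C) :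
    ∃ ψ : X →L[ℝ] ℝ, ∀ x, Tendsto (fun n => φ n x) 𝒰 (𝓝 (ψ x)) := by
  have hK := WeakDual.isCompact_closedBall (𝕜 := ℝ) (0 : StrongDual ℝ X) C
  obtain ⟨ψ, -, hψ⟩ := hK.ultrafilter_le_nhds (𝒰.map fun n => StrongDual.toWeakDual (φ n)) (by
    rw [Ultrafilter.coe_map, le_principal_iff]
    refine mem_map.2 (univ_mem' fun n => ?_)
    simpa using h n)
  refine ⟨WeakDual.toStrongDual ψ, fun x => ?_⟩
  have h1 := ((WeakDual.eval_continuous (𝕜 := ℝ) x).tendsto ψ).comp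
    (show Tendsto (fun n => StrongDual.toWeakDual (φ n)) 𝒰 (𝓝 ψ) from hψ)
  exact h1

/-- The image under `T` of every sequence in the unit ball has a weak limit along the hyperfilter.
Every weakly compact operator has this property. -/
def HasWeakUltralimits (T : X →L[ℝ] Y) : Prop :=
  ∀ u : ℕ → X, (∀ n, ‖u n‖ ≤ 1) →
    ∃ w, ∀ f : Y →L[ℝ] ℝ, Tendsto (fun n => f (T (u n))) (hyperfilter ℕ : Filter ℕ) (𝓝 (f w))

theorem HasWeakUltralimits.sum {ι : Type*} (s : Finset ι) {T : ι → X →L[ℝ] Y}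
    (hT : ∀ i ∈ s, HasWeakUltralimits (T i)) : HasWeakUltralimits (∑ i ∈ s, T i) := by
  intro u hu
  choose! w hw using fun i (hi : i ∈ s) => hT i hi u hu
  refine ⟨∑ i ∈ s, w i, fun f => ?_⟩
  simp only [sum_apply, map_sum]
  exact tendsto_finsetSum s fun i hi => hw i hi f

theorem IsReflexiveSpace.hasWeakUltralimits {V : Submodule ℝ Y} (hV : IsReflexiveSpace V)
    {T : X →L[ℝ] Y} (hT : ∀ x, T x ∈ V) : HasWeakUltralimits T := by
  intro u hu
  set v : ℕ → V := fun n => ⟨T (u n), hT _⟩ with hv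
  obtain ⟨ψ, hψ⟩ := exists_forall_tendsto_apply_of_norm_le (hyperfilter ℕ) (C := ‖T‖)
    (φ := fun n => NormedSpace.inclusionInDoubleDual ℝ V (v n)) fun n => by
      refine (NormedSpace.double_dual_bound ℝ V (v n)).trans ?_
      exact (T.le_opNorm _).trans (mul_le_of_le_one_right (norm_nonneg _) (hu n))
  obtain ⟨w, rfl⟩ := hV ψ
  exact ⟨w, fun f => hψ (f.comp V.subtypeL)⟩

end WeakUltralimits

/-! ### From weak to norm approximation -/

section Daugavet

variable {X Y : Type*} [NormedAddCommGroup X] [NormedSpace ℝ X]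
  [NormedAddCommGroup Y] [NormedSpace ℝ Y]

/-- A functional separating `p` from a convex set at positive distance, normalised on the set. -/
theorem exists_one_le_apply_sub {Z : Set Y} (hZ : Convex ℝ Z) {p : Y} {ε : ℝ} (hε : 0 < ε)
    (hp : ∀ z ∈ Z, ε ≤ ‖z - p‖) :
    ∃ v : Y →L[ℝ] ℝ, ‖v‖ ≤ 2 / ε ∧ ∀ z ∈ Z, 1 ≤ v (z - p) := by
  obtain ⟨f, u, hf, hu⟩ := geometric_hahn_banach_open (convex_ball p ε) Metric.isOpen_ball hZ
    (disjoint_left.2 fun z hz hzZ => by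
      rw [Metric.mem_ball, dist_eq_norm] at hz
      exact (hp z hzZ).not_gt hz)
  have hd : 0 < u - f p := sub_pos.2 (hf p (Metric.mem_ball_self hε))
  have hlt : ∀ y, ‖y‖ < ε → f y < u - f p := fun y hy => by
    have := hf (p + y) (by simpa using hy)
    rw [map_add] at this
    linarith
  refine ⟨(u - f p)⁻¹ • f, ?_, fun z hz => ?_⟩
  · refine ContinuousLinearMap.opNorm_le_of_unit_norm (by positivity) fun y hy => ?_
    have hn : ‖(ε / 2) • y‖ < ε := by
      rw [norm_smul, hy, Real.norm_of_nonneg (by positivity)]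
      linarith
    have h1 := hlt _ hn
    have h2 := hlt (-((ε / 2) • y)) (by rwa [norm_neg])
    rw [map_neg] at h2
    rw [map_smul, smul_eq_mul] at h1 h2
    rw [smul_apply, smul_eq_mul, Real.norm_eq_abs, abs_mul, abs_inv, abs_of_pos hd,
      inv_mul_le_iff₀ hd, mul_div_assoc', le_div_iff₀ hε]
    have h3 : |f y| * ε = 2 * |ε / 2 * f y| := by
      rw [abs_mul, abs_of_pos (half_pos hε)]
      ring
    have h4 : |ε / 2 * f y| ≤ u - f p := abs_le.2 ⟨by linarith, h1.le⟩
    linarith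
  · rw [smul_apply, smul_eq_mul, map_sub, ← div_eq_inv_mul, le_div_iff₀ hd]
    linarith [hu z hz]

/-- James' criterion: there is no sequence whose weak limit along the hyperfilter is separated
from itself by the tails. -/
theorem not_exists_forall_separated {y : ℕ → Y} {p w : Y} {v : ℕ → Y →L[ℝ] ℝ} {C : ℝ}
    (hw : ∀ f : Y →L[ℝ] ℝ, Tendsto (fun n => f (y n)) (hyperfilter ℕ : Filter ℕ) (𝓝 (f w)))
    (hv : ∀ n, ‖v n‖ ≤ C) (h1 : ∀ n i, i < n → 1 ≤ v n (y i - p))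
    (h2 : ∀ n i, n ≤ i → v n (y i - p) ≤ 1 / 2) : False := by
  obtain ⟨ψ, hψ⟩ := exists_forall_tendsto_apply_of_norm_le (hyperfilter ℕ) hv
  have hev : ∀ {P : ℕ → Prop} (n : ℕ), (∀ i, n ≤ i → P i) →
      ∀ᶠ i in (hyperfilter ℕ : Filter ℕ), P i := fun n h =>
    Nat.hyperfilter_le_atTop (eventually_atTop.2 ⟨n, h⟩)
  have hy : ∀ f : Y →L[ℝ] ℝ,
      Tendsto (fun n => f (y n - p)) (hyperfilter ℕ : Filter ℕ) (𝓝 (f (w - p))) := fun f => by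
    simp only [map_sub]
    exact (hw f).sub_const _
  -- The two iterated limits of `v n (y i - p)` both equal `ψ (w - p)`, but one is at least `1` and
  -- the other at most `1 / 2`.
  have h3 : ∀ i, 1 ≤ ψ (y i - p) := fun i =>
    ge_of_tendsto (hψ _) (hev (i + 1) fun n hn => h1 n i hn)
  have h4 : 1 ≤ ψ (w - p) := ge_of_tendsto (hy ψ) (Eventually.of_forall h3)
  have h5 : ∀ n, v n (w - p) ≤ 1 / 2 := fun n => le_of_tendsto (hy (v n)) (hev n fun i => h2 n i)
  have h6 : ψ (w - p) ≤ 1 / 2 := le_of_tendsto (hψ _) (Eventually.of_forall h5)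
  linarith

/-- In a space with the Daugavet property, every element of the unit ball can be approximated,
relative to an operator with weak limits, by elements almost `ℓ¹`-orthogonal to a given
finite-dimensional subspace. -/
theorem HasDaugavetProperty.exists_mem_almostL1_norm_lt [Nontrivial X]
    (hX : HasDaugavetProperty X) {T : X →L[ℝ] Y} (hT : HasWeakUltralimits T) {x : X}
    (hx : ‖x‖ ≤ 1) (E : Submodule ℝ X) [FiniteDimensional ℝ E] {η : ℝ} (hη : 0 < η) {ε : ℝ}
    (hε : 0 < ε) : ∃ z ∈ almostL1 E η, ‖T z - T x‖ < ε := by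
  classical
  by_contra! hcon
  -- A state holds the convex hull of the points so far, a finite-dimensional space containing it,
  -- and the functionals so far. The strict `κ < η` leaves room for the next point.
  let State := {S : Set X × Submodule ℝ X × Finset (Y →L[ℝ] ℝ) //
    Convex ℝ S.1 ∧ S.1 ⊆ S.2.1 ∧ E ≤ S.2.1 ∧ FiniteDimensional ℝ S.2.1 ∧
      ∃ κ, 0 ≤ κ ∧ κ < η ∧ S.1 ⊆ almostL1 E κ}
  have step : ∀ S : State, ∃ (S' : State) (z : X) (v : Y →L[ℝ] ℝ), S.1.1 ⊆ S'.1.1 ∧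
      S.1.2.2 ⊆ S'.1.2.2 ∧ z ∈ S'.1.1 ∧ ‖z‖ ≤ 1 ∧ v ∈ S'.1.2.2 ∧ ‖v‖ ≤ 2 / ε ∧
      (∀ y ∈ S.1.1, 1 ≤ v (T y - T x)) ∧ ∀ φ ∈ S'.1.2.2, φ (T z - T x) ≤ 1 / 2 := by
    rintro ⟨⟨Z, E', Φ⟩, hZ, hZE, hE, hfin, κ, hκ0, hκ, hZκ⟩
    simp only at hZ hZE hE hfin hZκ
    obtain ⟨v, hv, hvZ⟩ := exists_one_le_apply_sub (hZ.linear_image (T : X →ₗ[ℝ] Y)) hε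
      (p := T x) (by
        rintro _ ⟨z, hz, rfl⟩
        exact hcon z (almostL1_mono le_rfl hκ.le (hZκ hz)))
    set Φ' := insert v Φ with hΦ'
    set F : X →L[ℝ] (Φ' → ℝ) := ContinuousLinearMap.pi fun φ => φ.1.comp T with hF
    -- Spending at most half the remaining tolerance keeps the total below `η` forever.
    set κ' := min ((η - κ) / 2) 1 with hκ'
    have hκ'0 : 0 < κ' := lt_min (by linarith) one_pos
    have hκ'1 := min_le_left ((η - κ) / 2) 1
    obtain ⟨_, ⟨z, hz, rfl⟩, hFz⟩ := Metric.mem_closure_iff.1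
      (hX.mem_closure_image_almostL1 F hx E' hκ'0) (1 / 2) (by norm_num)
    have hzE : z ∈ E' ⊔ Submodule.span ℝ {z} :=
      Submodule.mem_sup_right (Submodule.mem_span_singleton_self z)
    have hsub : convexHull ℝ (insert z Z) ⊆ almostL1 E (κ + κ') := by
      rcases Z.eq_empty_or_nonempty with rfl | hne
      · simpa using almostL1_mono hE (by linarith) hz
      · rw [convexHull_insert hne, hZ.convexHull_eq, convexJoin_singleton_left]
        refine iUnion₂_subset fun y hy => ?_
        rintro _ ⟨a, b, ha, hb, hab, rfl⟩
        rw [add_comm (a • z)]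
        exact add_smul_mem_almostL1 hκ0 hκ'0.le (min_le_right _ _) (hZκ hy) hz hE (hZE hy) hb ha
          ((add_comm b a).trans hab)
    refine ⟨⟨⟨convexHull ℝ (insert z Z), E' ⊔ Submodule.span ℝ {z}, Φ'⟩,
      convex_convexHull ℝ _, ?_, hE.trans le_sup_left, ?_, κ + κ', by linarith, by linarith,
      hsub⟩, z, v, ?_, Finset.subset_insert _ _, ?_, hz.1, Finset.mem_insert_self _ _, hv, ?_, ?_⟩
    · refine convexHull_min (insert_subset hzE fun y hy => ?_) (Submodule.convex _)
      exact Submodule.mem_sup_left (hZE hy)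
    · exact Submodule.finiteDimensional_sup _ _
    · exact (subset_insert _ _).trans (subset_convexHull ℝ _)
    · exact subset_convexHull ℝ _ (mem_insert _ _)
    · exact fun y hy => hvZ _ ⟨y, hy, rfl⟩
    · intro φ hφ
      have h1 := (dist_pi_le_iff (by norm_num)).1 hFz.le ⟨φ, hφ⟩
      rw [dist_comm, Real.dist_eq] at h1
      rw [map_sub]
      exact (le_abs_self _).trans h1
  choose next z v hZ hΦ hz hz1 hv hvn hvZ hφ using step
  let S : ℕ → State := fun n => next^[n] ⟨⟨∅, E, ∅⟩, convex_empty, empty_subset _, le_rfl,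
    inferInstance, 0, le_rfl, hη, empty_subset _⟩
  have hS : ∀ n, S (n + 1) = next (S n) := fun n => Function.iterate_succ_apply' _ _ _
  have hZm : Monotone fun n => (S n).1.1 := monotone_nat_of_le_succ fun n => by
    simp only [hS]
    exact hZ _
  have hΦm : Monotone fun n => (S n).1.2.2 := monotone_nat_of_le_succ fun n => by
    simp only [hS]
    exact hΦ _
  obtain ⟨w, hw⟩ := hT (fun n => z (S n)) fun n => hz1 _
  refine not_exists_forall_separated (p := T x) (v := fun n => v (S n)) hw (fun n => hvn _) ?_ ?_
  -- Stage `i` puts its point, and stage `n` its functional, into the following state: `v (S n)`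
  -- separates only points with `i < n`, while the point of stage `i` respects all functionals with
  -- `n ≤ i`.
  · intro n i hi
    refine hvZ (S n) _ (hZm (Nat.succ_le_of_lt hi) ?_)
    change z (S i) ∈ (S (i + 1)).1.1
    rw [hS]
    exact hz _
  · intro n i hi
    refine hφ (S i) _ ?_
    rw [← hS]
    refine hΦm (Nat.succ_le_succ hi) ?_
    change v (S n) ∈ (S (n + 1)).1.2.2
    rw [hS]
    exact hv _

end Daugavet

/-! ### Unconditional sums -/

section UnconditionalSum

variable {ι X Y : Type*} [NormedAddCommGroup X] [NormedSpace ℝ X]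
  [NormedAddCommGroup Y] [NormedSpace ℝ Y]

namespace IsUnconditionalSum

variable {V : ι → Submodule ℝ Y} {P : ι → Y →L[ℝ] Y}

theorem apply_mem (h : IsUnconditionalSum V P) (i : ι) (y : Y) : P i y ∈ V i := by
  rw [← h.range_eq i]
  exact ⟨y, rfl⟩

/-- The partial sum projections are uniformly bounded. -/
theorem exists_norm_sum_le [CompleteSpace Y] (h : IsUnconditionalSum V P) :
    ∃ K, ∀ s : Finset ι, ‖∑ i ∈ s, P i‖ ≤ K := by
  classical
  refine banach_steinhaus fun y => ?_
  obtain ⟨s₀, hs₀⟩ := summable_iff_vanishing_norm.1 (h.hasSum y).summable 1 one_pos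
  refine ⟨∑ i ∈ s₀, ‖P i y‖ + 1, fun s => ?_⟩
  rw [sum_apply, ← Finset.sum_inter_add_sum_sdiff s s₀]
  refine (norm_add_le _ _).trans (add_le_add ?_ (hs₀ _ Finset.sdiff_disjoint).le)
  exact (norm_sum_le _ _).trans (Finset.sum_le_sum_of_subset_of_nonneg Finset.inter_subset_right
    fun _ _ _ => norm_nonneg _)

theorem sum_apply_sum_apply (h : IsUnconditionalSum V P) {s t : Finset ι} (hst : s ⊆ t) (y : Y) :
    (∑ i ∈ s, P i) ((∑ i ∈ t, P i) y) = (∑ i ∈ s, P i) y := by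
  classical
  refine (sum_apply _ _ _).trans ((Finset.sum_congr rfl fun i hi => ?_).trans
    (sum_apply _ _ _).symm)
  rw [sum_apply, map_sum, Finset.sum_eq_single i]
  · exact h.apply_self i _ (h.apply_mem i y)
  · exact fun j _ hji => h.apply_of_ne i j hji.symm _ (h.apply_mem j y)
  · exact fun hi' => absurd (hst hi) hi'

theorem exists_norm_sub_sum_lt (h : IsUnconditionalSum V P) (s : Finset ι) (y : Y) {ε : ℝ}
    (hε : 0 < ε) : ∃ t, s ⊆ t ∧ ‖y - (∑ i ∈ t, P i) y‖ < ε := by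
  have h1 := (Metric.tendsto_nhds.1 (h.hasSum y) ε hε).and (eventually_ge_atTop s)
  obtain ⟨t, ht, hst⟩ := h1.exists
  refine ⟨t, hst, ?_⟩
  rwa [dist_comm, dist_eq_norm, ← sum_apply] at ht

/-- If `X` has the Daugavet property and all `P i ∘ J` have weak limits, then one finds arbitrarily
large `s` whose images `J s` are almost partial sums of `J x`, for some `x` in the unit ball. -/
theorem exists_norm_ge [Nontrivial X] (hX : HasDaugavetProperty X) (h : IsUnconditionalSum V P)
    {J : X →L[ℝ] Y} (hJ : ∀ i, HasWeakUltralimits ((P i).comp J)) {K : ℝ}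
    (hK : ∀ s : Finset ι, ‖∑ i ∈ s, P i‖ ≤ K) (n : ℕ) {ε : ℝ} (hε : 0 < ε) :
    ∃ (x s : X) (F G : Finset ι), G ⊆ F ∧ ‖x‖ ≤ 1 ∧ ‖J x - (∑ i ∈ F, P i) (J x)‖ < ε ∧
      ‖(∑ i ∈ G, P i) (J x) - J s‖ < ε ∧ (n : ℝ) ≤ ‖s‖ := by
  classical
  have hK0 : 0 ≤ K := (norm_nonneg _).trans (hK ∅)
  have hle : ∀ {G F : Finset ι}, G ⊆ F → ∀ y,
      ‖(∑ i ∈ G, P i) y‖ ≤ K * ‖(∑ i ∈ F, P i) y‖ := fun hGF y => by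
    rw [← h.sum_apply_sum_apply hGF]
    exact (ContinuousLinearMap.le_opNorm _ _).trans
      (mul_le_mul_of_nonneg_right (hK _) (norm_nonneg _))
  have next : ∀ (x e : X) (F : Finset ι) {δ : ℝ}, ‖x‖ ≤ 1 → 0 < δ →
      ∃ (x' : X) (F' : Finset ι), F ⊆ F' ∧ ‖x'‖ ≤ 1 ∧ ‖e‖ + 1 / 2 ≤ ‖e + x'‖ ∧
        ‖(∑ i ∈ F, P i) (J (x' - x))‖ < δ ∧ ‖J x' - (∑ i ∈ F', P i) (J x')‖ < δ := by
    intro x e F δ hx hδ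
    have hT : HasWeakUltralimits (∑ i ∈ F, (P i).comp J) := .sum F fun i _ => hJ i
    obtain ⟨x', hx', hlt⟩ := hX.exists_mem_almostL1_norm_lt hT hx (Submodule.span ℝ {e})
      -- Chosen so that `(1 - η) * (‖e‖ + 1) = ‖e‖ + 1 / 2`.
      (η := 1 / (2 * (‖e‖ + 1))) (by positivity) hδ
    obtain ⟨F', hF, hF'⟩ := h.exists_norm_sub_sum_lt F (J x') hδ
    refine ⟨x', F', hF, hx'.1, ?_, ?_, hF'⟩
    · have h1 := hx'.2 e (Submodule.mem_span_singleton_self e) 1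
      rw [abs_one, one_smul] at h1
      refine le_trans (le_of_eq ?_) h1
      have : ‖e‖ + 1 ≠ 0 := by positivity
      field_simp
      ring
    · rw [← map_sub] at hlt
      simpa only [sum_apply, ContinuousLinearMap.comp_apply] using hlt
  induction n generalizing ε with
  | zero => exact ⟨0, 0, ∅, ∅, by simp, by simp, by simpa, by simpa, by simp⟩
  | succ n ih =>
    obtain ⟨δ, hδ, hδε⟩ : ∃ δ > 0, δ * (2 * K + 5) ≤ ε :=
      ⟨ε / (2 * K + 5), by positivity, by rw [div_mul_cancel₀]; positivity⟩
    -- Two moves `x → x' → x''` lengthen `s + (x'' - x')` by `1 / 2` each. `J (x'' - x')` is nearly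
    -- the part of `J x''` over `F'' \ F'`, while the part over `G` has barely moved, so `G ∪ (F'' \
    -- F')` works.
    obtain ⟨x, s, F, G, hGF, hx, hxF, hxG, hs⟩ := ih hδ
    obtain ⟨x', F', hF', hx', hs', hxx', hxF'⟩ := next x (-s) F hx hδ
    obtain ⟨x'', F'', hF'', hx'', hs'', hxx'', hxF''⟩ := next x' (s - x') F' hx' hδ
    have hK' := mul_nonneg hK0 hδ.le
    have hG' := hle hGF (J (x' - x))
    have hG'' := hle (hGF.trans hF') (J (x'' - x'))
    have hG1 := mul_le_mul_of_nonneg_left hxx'.le hK0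
    have hG2 := mul_le_mul_of_nonneg_left hxx''.le hK0
    refine ⟨x'', s + (x'' - x'), F'', G ∪ (F'' \ F'), ?_, hx'', ?_, ?_, ?_⟩
    · exact Finset.union_subset ((hGF.trans hF').trans hF'') Finset.sdiff_subset
    · nlinarith
    · have hdisj : Disjoint G (F'' \ F') :=
        Finset.disjoint_sdiff.mono_left (hGF.trans hF')
      have hsd : (∑ i ∈ F'' \ F', P i) = ∑ i ∈ F'', P i - ∑ i ∈ F', P i :=
        eq_sub_of_add_eq (Finset.sum_sdiff hF'')
      rw [Finset.sum_union hdisj, hsd]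
      set Q := ∑ i ∈ G, P i
      set Q' := ∑ i ∈ F', P i
      set Q'' := ∑ i ∈ F'', P i
      have heq : (Q + (Q'' - Q')) (J x'') - J (s + (x'' - x')) =
          (Q (J x) - J s) + Q (J (x' - x)) + Q (J (x'' - x')) - (J x'' - Q'' (J x''))
            - Q' (J (x'' - x')) + (J x' - Q' (J x')) := by
        simp only [add_apply, sub_apply, map_add, map_sub]
        abel
      rw [heq]
      have t1 := norm_add_le ((Q (J x) - J s) + Q (J (x' - x)) + Q (J (x'' - x'))
        - (J x'' - Q'' (J x'')) - Q' (J (x'' - x'))) (J x' - Q' (J x'))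
      have t2 := norm_sub_le ((Q (J x) - J s) + Q (J (x' - x)) + Q (J (x'' - x'))
        - (J x'' - Q'' (J x''))) (Q' (J (x'' - x')))
      have t3 := norm_sub_le ((Q (J x) - J s) + Q (J (x' - x)) + Q (J (x'' - x')))
        (J x'' - Q'' (J x''))
      have t4 := norm_add₃_le (a := Q (J x) - J s) (b := Q (J (x' - x))) (c := Q (J (x'' - x')))
      linarith
    · have h1 : -s + x' = -(s - x') := by abel
      have h2 : s + (x'' - x') = s - x' + x'' := by abel
      rw [h1, norm_neg, norm_neg] at hs'
      rw [h2]
      push_cast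
      linarith

/-- The vectors `s` of `exists_norm_ge` satisfy `‖J s‖ < K * ‖J‖ + 1` with `‖s‖` unbounded, against
continuity of the inverse of `J` at `0`. -/
theorem not_embedsInto [Nontrivial X] [CompleteSpace Y] (hX : HasDaugavetProperty X)
    (h : IsUnconditionalSum V P) (hV : ∀ i, IsReflexiveSpace (V i)) : ¬ EmbedsInto X Y := by
  rintro ⟨J, hJ⟩
  obtain ⟨K, hK⟩ := h.exists_norm_sum_le
  have hK0 : 0 ≤ K := (norm_nonneg _).trans (hK ∅)
  have hball : Metric.ball (0 : X) 1 ∈ comap J (𝓝 (J 0)) := by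
    rw [← hJ.isInducing.nhds_eq_comap]
    exact Metric.ball_mem_nhds _ one_pos
  rw [map_zero] at hball
  obtain ⟨r, hr, hrJ⟩ := (Metric.nhds_basis_ball.comap J).mem_iff.1 hball
  obtain ⟨n, hn⟩ := exists_nat_gt ((K * ‖J‖ + 1) / r)
  have hn0 : (0 : ℝ) < n := lt_of_le_of_lt (by positivity) hn
  rw [div_lt_iff₀ hr] at hn
  obtain ⟨x, s, -, G, -, hx, -, hG, hs⟩ := h.exists_norm_ge hX (J := J)
    (fun i => (hV i).hasWeakUltralimits fun x => h.apply_mem i _) hK n one_pos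
  have h1 : ‖(∑ i ∈ G, P i) (J x)‖ ≤ K * ‖J‖ := by
    refine (ContinuousLinearMap.le_opNorm _ _).trans (mul_le_mul (hK G) ?_ (norm_nonneg _) hK0)
    exact (J.le_opNorm x).trans (mul_le_of_le_one_right (norm_nonneg _) hx)
  have h2 : ‖J s‖ < n * r := by
    have := norm_sub_norm_le (J s) ((∑ i ∈ G, P i) (J x))
    rw [norm_sub_rev] at this
    linarith
  have h3 : (n : ℝ)⁻¹ • s ∈ Metric.ball (0 : X) 1 := hrJ (by
    rw [mem_preimage, mem_ball_zero_iff, map_smul, norm_smul, norm_inv, Real.norm_of_nonneg hn0.le,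
      inv_mul_lt_iff₀ hn0]
    exact h2)
  rw [mem_ball_zero_iff, norm_smul, norm_inv, Real.norm_of_nonneg hn0.le,
    inv_mul_lt_iff₀ hn0] at h3
  linarith

end IsUnconditionalSum

theorem isReflexiveSpace_of_finiteDimensional [FiniteDimensional ℝ Y] : IsReflexiveSpace Y := by
  have e1 : Module.finrank ℝ (StrongDual ℝ Y) = Module.finrank ℝ Y := by
    rw [← (LinearMap.toContinuousLinearMap (𝕜 := ℝ) (E := Y) (F' := ℝ)).finrank_eq]
    exact Subspace.dual_finrank_eq
  have : FiniteDimensional ℝ (StrongDual ℝ Y) := inferInstance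
  have e2 : Module.finrank ℝ (StrongDual ℝ (StrongDual ℝ Y))
      = Module.finrank ℝ (StrongDual ℝ Y) := by
    rw [← (LinearMap.toContinuousLinearMap (𝕜 := ℝ) (E := StrongDual ℝ Y) (F' := ℝ)).finrank_eq]
    exact Subspace.dual_finrank_eq
  refine (LinearMap.injective_iff_surjective_of_finrank_eq_finrank
    (f := (NormedSpace.inclusionInDoubleDual ℝ Y : Y →ₗ[ℝ] StrongDual ℝ (StrongDual ℝ Y)))
    (by rw [e2, e1])).1 ?_
  exact (NormedSpace.inclusionInDoubleDualLi ℝ (E := Y)).injective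

theorem UnconditionalSchauderBasis.isUnconditionalSum (b : UnconditionalSchauderBasis ι ℝ Y) :
    IsUnconditionalSum (fun i => Submodule.span ℝ {b.basis i})
      (fun i => (b.coord i).smulRight (b.basis i)) where
  range_eq i := by
    ext y
    simp only [LinearMap.mem_range, Submodule.mem_span_singleton]
    constructor
    · rintro ⟨z, rfl⟩
      exact ⟨b.coord i z, by simp⟩
    · rintro ⟨a, rfl⟩
      exact ⟨a • b.basis i, by simp [b.ortho]⟩
  apply_self i y hy := by
    obtain ⟨a, rfl⟩ := Submodule.mem_span_singleton.1 hy
    simp [b.ortho]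
  apply_of_ne i j hij y hy := by
    obtain ⟨a, rfl⟩ := Submodule.mem_span_singleton.1 hy
    simp [b.ortho, hij]
  hasSum := b.expansion

end UnconditionalSum

theorem corollary2p6 {X : Type*} [NormedAddCommGroup X] [NormedSpace ℝ X] [CompleteSpace X]
    [TopologicalSpace.SeparableSpace X] [Nontrivial X] (hX : HasDaugavetProperty X) :
    (∀ (ι Y : Type*) [NormedAddCommGroup Y] [NormedSpace ℝ Y] [CompleteSpace Y]
      (V : ι → Submodule ℝ Y) (P : ι → Y →L[ℝ] Y),
      IsUnconditionalSum V P → (∀ i, IsReflexiveSpace (V i)) → ¬ EmbedsInto X Y) ∧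
    (∀ (ι Y : Type*) [NormedAddCommGroup Y] [NormedSpace ℝ Y] [CompleteSpace Y],
      UnconditionalSchauderBasis ι ℝ Y → ¬ EmbedsInto X Y) :=
  ⟨fun _ _ _ _ _ _ _ h hV => h.not_embedsInto hX hV, fun _ _ _ _ _ b =>
    b.isUnconditionalSum.not_embedsInto hX fun _ => isReflexiveSpace_of_finiteDimensional⟩
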